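/- Let $P=\{y\in\mathbb R^n : l_k(y)\ge 0,\ k=1,\dots,d\}$ be a compact polytope with non-empty interior, where the $l_k$ are affine functions (for instance the moment polytope of a toric Kähler manifold). Let $\psi_0:\mathbb R^n\to\mathbb R$ be smooth and strictly convex with $\overline{\operatorname{Im}\nabla\psi_0}=P$, and suppose that its Legendre dual $u_0(y)=\psi_0^*(y)=\sup_{x\in\mathbb R^n}(\langle x,y\rangle-\psi_0(x))$ satisfies $u_0=\sum_k l_k\log l_k+F$ on $P\setminus\partial P$ for some $F\in C^\infty(P)$ (smooth up to the boundary). Let $\dot\psi_0:\mathbb R^n\to\mathbb R$ be such that $-\dot\psi_0\circ(\nabla\psi_0)^{-1}$ is the restriction to $\operatorname{Im}\nabla\psi_0$ of a function $\dot u_0\in C^\infty(P)$. Put $$\psi(s,x)=\sup_{y\in P}\bigl(\langle x,y\rangle-u_0(y)-s\,\dot u_0(y)\bigr),$$ a convex function of $(s,x)\in\mathbb R\times\mathbb R^n$, and for a set $S\subset\mathbb R\times\mathbb R^n$ let $\int_S\mathrm{MA}\,\psi$ denote the Lebesgue measure of $\partial\psi(S)=\bigcup_{p\in S}\partial\psi(p)\subset\mathbb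 R^{n+1}$, where $\partial\psi$ is the subdifferential. For a function $f$ on $P$ let $\operatorname{epi}f=\{(y,r): y\in P,\ r\ge f(y)\}$, and let $(\dot u_0)^{**}$ be the biconjugate (convexification) of $\dot u_0$ on $P$. Then for every $T>0$ $$\int_{[0,T]\times\mathbb R^n}\mathrm{MA}\,\psi\ \le\ \mathrm{Vol}\bigl(\operatorname{epi}(-\dot u_0)\setminus\operatorname{epi}(-(\dot u_0)^{**})\bigr),$$ and the right-hand side equals the volume in $\mathbb R^{n+1}$ of the region $\{(y,r): y\in P,\ (\dot u_0)^{**}(y)\le r\le \dot u_0(y)\}$ below the graph of $\dot u_0$ and above the graph of its convexification. In particular the bound depends only on the Cauchy data $(\psi_0,\dot\psi_0)$, not on $T$. -/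

import Mathlib

open Set MeasureTheory
open scoped ContDiff InnerProductSpace

noncomputable section

namespace HRMA

/-- `ℝⁿ` with its Euclidean inner product and Lebesgue measure. -/
abbrev E (n : ℕ) : Type := EuclideanSpace ℝ (Fin n)

/-- The Legendre-Fenchel conjugate of a function `f` on the set `S` (extended by `+∞` off `S`):
`f^*(x) = sup_{y ∈ S} (⟨x, y⟩ - f y)`. It is used only where this supremum is finite. -/
def legendre {n : ℕ} (S : Set (E n)) (f : E n → ℝ) (x : E n) : ℝ :=
  ⨆ y : S, (⟪x, (y : E n)⟫_ℝ - f y)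

/-- The biconjugate (convexification) `f^{**}` of a function `f` on `P`. -/
def biconjugate {n : ℕ} (P : Set (E n)) (f : E n → ℝ) : E n → ℝ :=
  legendre univ (legendre P f)

/-- The epigraph, over `P`, of a function `f`. -/
def epi {n : ℕ} (P : Set (E n)) (f : E n → ℝ) : Set (E n × ℝ) :=
  {q | q.1 ∈ P ∧ f q.1 ≤ q.2}

/-- The affine function `y ↦ ⟨ν, y⟩ - c`. -/
def affineFn {n : ℕ} (ν : E n) (c : ℝ) (y : E n) : ℝ := ⟪ν, y⟫_ℝ - c

/-- The polyhedron cut out by the inequalities `l_k ≥ 0`, where `l_k y = ⟨ν_k, y⟩ - c_k`. -/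
def polytope {n d : ℕ} (ν : Fin d → E n) (c : Fin d → ℝ) : Set (E n) :=
  {y | ∀ k, 0 ≤ affineFn (ν k) (c k) y}

/-- Guillemin's function `u_G = ∑_k l_k log l_k`. -/
def guillemin {n d : ℕ} (ν : Fin d → E n) (c : Fin d → ℝ) (y : E n) : ℝ :=
  ∑ k, affineFn (ν k) (c k) y * Real.log (affineFn (ν k) (c k) y)

/-- `ψ₀` is (the restriction to the open orbit, in logarithmic coordinates, of) a torus-invariant
Kähler potential with moment polytope `P = {l_k ≥ 0}`: it is smooth and strictly convex on `ℝⁿ`,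
the closure of the image of its gradient is `P`, and its Legendre dual (the symplectic potential)
differs from `u_G` by a function smooth up to the boundary of `P`. -/
structure IsOpenOrbitPotential {n d : ℕ} (ν : Fin d → E n) (c : Fin d → ℝ)
    (ψ₀ : E n → ℝ) : Prop where
  smooth : ContDiff ℝ ∞ ψ₀
  strictConvex : StrictConvexOn ℝ univ ψ₀
  closure_range_gradient : closure (range (gradient ψ₀)) = polytope ν c
  boundary : ∃ F : E n → ℝ, ContDiffOn ℝ ∞ F (polytope ν c) ∧
    ∀ y ∈ interior (polytope ν c), legendre univ ψ₀ y = guillemin ν c y + F y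

/-- `udot` is the initial velocity of the symplectic potential determined by the Cauchy data
`(ψ₀, ψdot)`: the function, smooth up to the boundary of `P`, with
`udot = -ψdot ∘ (∇ψ₀)⁻¹` on the image of `∇ψ₀`. -/
structure IsInitialVelocity {n : ℕ} (P : Set (E n)) (ψ₀ ψdot udot : E n → ℝ) : Prop where
  smooth : ContDiffOn ℝ ∞ udot P
  apply_gradient : ∀ x, udot (gradient ψ₀ x) = -ψdot x

/-- The Legendre transform potential `ψ(s, x) = (u₀ + s udot)^*(x)`, where `u₀ = ψ₀^*`, the
conjugate being taken over `P`. -/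
def legendrePotential {n : ℕ} (P : Set (E n)) (ψ₀ udot : E n → ℝ) (p : ℝ × E n) : ℝ :=
  legendre P (fun y => legendre univ ψ₀ y + p.1 * udot y) p.2

/-- The subdifferential of a function on `ℝ × ℝⁿ = ℝⁿ⁺¹`. -/
def subdifferential {n : ℕ} (f : ℝ × E n → ℝ) (p : ℝ × E n) : Set (ℝ × E n) :=
  {v | ∀ z : ℝ × E n, f p + (v.1 * (z.1 - p.1) + ⟪v.2, z.2 - p.2⟫_ℝ) ≤ f z}

/-- The Monge-Ampère mass which a convex function `f` on `ℝⁿ⁺¹` gives to a set `S`: the Lebesgue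
measure of the image `∂f(S)` of `S` under the subdifferential. -/
def mongeAmpere {n : ℕ} (f : ℝ × E n → ℝ) (S : Set (ℝ × E n)) : ENNReal :=
  volume (⋃ p ∈ S, subdifferential f p)

end HRMA

end

/-!
The proof locates the image of the subdifferential. Let `v = (v₁, v₂)` be a subgradient of `ψ` at
`(s, x)` with `s ≥ 0`, and write `w` for `udot` and `u₀` for the conjugate of `ψ₀`.

Since `ψ` is the supremum over `y ∈ P` of affine functions with linear parts `(-w y, y)`, its
subgradients satisfy every linear inequality that holds on the graph of `-w` over `P`
(`subgradient_le`). Hence `v₂ ∈ P` (`snd_mem_polytope`) and `v₁ ≤ -w^{**}(v₂)`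
(`biconjugate_snd_le_neg_fst`). In the opposite direction, `v₁ ≥ -w(v₂)`: for `s > 0` this follows
by comparing `ψ` at `(s, x)` with the slice `s = 0` (`neg_le_fst_of_pos`), and for `s = 0` it uses
that `∇ψ₀ x` is the only point at which the supremum defining `ψ(0, x)` is attained
(`neg_le_fst_of_zero`).

Thus, up to the order of the two factors, the image lies in the region
`{-w ≤ r ≤ -w^{**}}` over `P`, which differs from the difference of the two epigraphs by the graph
of `-w^{**}`. This graph is null because the epigraph of `w^{**}` over `P` is closed
(`isClosed_epi_biconjugate`, `volume_graph_eq_zero`). Reflecting `r` gives the equality of volumes.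

All of this presupposes that the suprema involved are finite. The assumption on the boundary
behaviour of `u₀` enters only there (`exists_conjugate_bound`).
-/

open HRMA

/-! ### Conjugates -/

theorem le_legendre {n : ℕ} {S : Set (E n)} {f : E n → ℝ} {x y : E n}
    (h : BddAbove (range fun y : S => ⟪x, (y : E n)⟫_ℝ - f y)) (hy : y ∈ S) :
    ⟪x, y⟫_ℝ - f y ≤ legendre S f x :=
  le_ciSup h ⟨y, hy⟩

theorem legendre_le {n : ℕ} {S : Set (E n)} {f : E n → ℝ} {x : E n} {a : ℝ} (hS : S.Nonempty)
    (h : ∀ y ∈ S, ⟪x, y⟫_ℝ - f y ≤ a) : legendre S f x ≤ a :=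
  haveI := hS.to_subtype
  ciSup_le fun y => h y y.2

theorem bddAbove_inner_sub {n : ℕ} {S : Set (E n)} (hS : IsCompact S) {f : E n → ℝ} {m : ℝ}
    (hf : ∀ y ∈ S, m ≤ f y) (x : E n) :
    BddAbove (range fun y : S => ⟪x, (y : E n)⟫_ℝ - f y) := by
  obtain ⟨M, hM⟩ := hS.bddAbove_image (f := fun y => ⟪x, y⟫_ℝ) (by fun_prop)
  refine ⟨M - m, ?_⟩
  rintro _ ⟨y, rfl⟩
  have h1 := hM (mem_image_of_mem _ y.2)
  have h2 := hf y y.2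
  linarith

/-- On `S`, the supremum defining the biconjugate is bounded by `f`. -/
theorem bddAbove_biconjugate {n : ℕ} {S : Set (E n)} {f : E n → ℝ}
    (h : ∀ x, BddAbove (range fun y : S => ⟪x, (y : E n)⟫_ℝ - f y)) {y : E n} (hy : y ∈ S) :
    BddAbove (range fun z : (univ : Set (E n)) => ⟪y, (z : E n)⟫_ℝ - legendre S f z) := by
  refine ⟨f y, ?_⟩
  rintro _ ⟨z, rfl⟩
  have := le_legendre (h z) hy
  rw [real_inner_comm] at this
  simp only
  linarith

/-- Over a closed set, the epigraph of the biconjugate is closed, being an intersection of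
half-spaces. -/
theorem isClosed_epi_biconjugate {n : ℕ} {S : Set (E n)} (hS : IsClosed S) {f : E n → ℝ}
    (h : ∀ x, BddAbove (range fun y : S => ⟪x, (y : E n)⟫_ℝ - f y)) :
    IsClosed (epi S (biconjugate S f)) := by
  have : epi S (biconjugate S f) =
      {q | q.1 ∈ S} ∩ ⋂ z : E n, {q : E n × ℝ | ⟪q.1, z⟫_ℝ - legendre S f z ≤ q.2} := by
    ext q
    simp only [epi, mem_ofPred_eq, mem_inter_iff, mem_iInter]
    refine and_congr_right fun hq => ⟨fun hle z => ?_, fun hle => ?_⟩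
    · exact (le_legendre (bddAbove_biconjugate h hq) (mem_univ z)).trans hle
    · exact legendre_le univ_nonempty fun z _ => hle z
  rw [this]
  exact (hS.preimage continuous_fst).inter
    (isClosed_iInter fun z => isClosed_le (by fun_prop) (by fun_prop))

/-! ### Graphs and reflections -/

/-- The part over `S` of the graph of a function is null once the epigraph is measurable; the
function itself is not assumed measurable off `S`. -/
theorem volume_graph_eq_zero {n : ℕ} {S : Set (E n)} {f : E n → ℝ}
    (h : MeasurableSet (epi S f)) :
    volume {q : E n × ℝ | q.1 ∈ S ∧ q.2 = f q.1} = 0 := by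
  -- The graph is the epigraph without its translates by `1 / (k + 1)` upwards.
  have hgraph : {q : E n × ℝ | q.1 ∈ S ∧ q.2 = f q.1} =
      epi S f \ ⋃ k : ℕ, (fun q : E n × ℝ => (q.1, q.2 - 1 / ((k : ℝ) + 1))) ⁻¹' epi S f := by
    ext q
    simp only [epi, mem_ofPred_eq, mem_sdiff, mem_iUnion, mem_preimage, not_exists, not_and, not_le]
    constructor
    · rintro ⟨hq, he⟩
      refine ⟨⟨hq, he.ge⟩, fun k _ => ?_⟩
      have : (0 : ℝ) < 1 / ((k : ℝ) + 1) := by positivity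
      linarith
    · rintro ⟨⟨hq, hle⟩, hk⟩
      refine ⟨hq, le_antisymm (not_lt.1 fun hlt => ?_) hle⟩
      obtain ⟨k, hk'⟩ := exists_nat_one_div_lt (sub_pos.2 hlt)
      linarith [hk k hq]
  have hmeas : MeasurableSet {q : E n × ℝ | q.1 ∈ S ∧ q.2 = f q.1} := by
    rw [hgraph]
    exact h.diff (MeasurableSet.iUnion fun k => by
      apply MeasurableSet.preimage h
      fun_prop)
  rw [Measure.volume_eq_prod, Measure.measure_prod_null hmeas]
  refine Filter.Eventually.of_forall fun y => ?_
  refine measure_mono_null (t := {f y}) ?_ (by simp)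
  rintro r ⟨-, hr⟩
  exact hr

theorem volume_preimage_neg_snd {n : ℕ} (A : Set (E n × ℝ)) :
    volume ((fun q : E n × ℝ => (q.1, -q.2)) ⁻¹' A) = volume A :=
  ((MeasurePreserving.id (volume : Measure (E n))).prod
    (Measure.measurePreserving_neg (volume : Measure ℝ))).measure_preimage_equiv
      (f := MeasurableEquiv.prodCongr (MeasurableEquiv.refl _) (MeasurableEquiv.neg ℝ)) A

theorem volume_preimage_swap {n : ℕ} (A : Set (E n × ℝ)) :
    volume ((Prod.swap : ℝ × E n → E n × ℝ) ⁻¹' A) = volume A :=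
  (Measure.measurePreserving_swap (μ := (volume : Measure ℝ))
    (ν := (volume : Measure (E n)))).measure_preimage_equiv
      (f := MeasurableEquiv.prodComm) A

/-! ### Gradients of convex functions -/

theorem add_inner_gradient_le {n : ℕ} {f : E n → ℝ} (hf : ConvexOn ℝ univ f) {x : E n}
    (hd : DifferentiableAt ℝ f x) (z : E n) :
    f x + ⟪gradient f x, z - x⟫_ℝ ≤ f z := by
  have hconv : ConvexOn ℝ univ (f ∘ AffineMap.lineMap (k := ℝ) x z) := by
    simpa using hf.comp_affineMap (AffineMap.lineMap (k := ℝ) x z)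
  have hder : HasDerivAt (f ∘ AffineMap.lineMap (k := ℝ) x z) ⟪gradient f x, z - x⟫_ℝ 0 := by
    rw [inner_gradient_left]
    have h0 : HasFDerivAt f (fderiv ℝ f x) (AffineMap.lineMap (k := ℝ) x z (0 : ℝ)) := by
      simpa using hd.hasFDerivAt
    exact h0.comp_hasDerivAt (0 : ℝ) AffineMap.hasDerivAt_lineMap
  have := hconv.le_slope_of_hasDerivAt (mem_univ 0) (mem_univ 1) one_pos hder
  simp only [slope_def_field, Function.comp_apply, AffineMap.lineMap_apply_one,
    AffineMap.lineMap_apply_zero, sub_zero, div_one] at this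
  linarith

theorem eq_gradient_of_forall_le {n : ℕ} {f : E n → ℝ} {x : E n}
    (hd : DifferentiableAt ℝ f x) {v : E n} (hv : ∀ z, f x + ⟪v, z - x⟫_ℝ ≤ f z) :
    v = gradient f x := by
  have hmin : IsLocalMin (fun z => f z - ⟪v, z⟫_ℝ) x :=
    Filter.Eventually.of_forall fun z => by
      have := hv z
      rw [inner_sub_right] at this
      linarith
  have hder : HasFDerivAt (fun z => f z - ⟪v, z⟫_ℝ) (fderiv ℝ f x - innerSL ℝ v) x :=
    hd.hasFDerivAt.sub (innerSL ℝ v).hasFDerivAt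
  have h0 := hmin.hasFDerivAt_eq_zero hder
  refine ext_inner_right ℝ fun w => ?_
  have := congrArg (fun L => L w) h0
  simp only [sub_apply, innerSL_apply_apply, zero_apply] at this
  rw [inner_gradient_left]
  linarith

/-! ### The conjugate of the potential is finite on the polytope -/

/-- The effective domain of the conjugate `f^*`. -/
def conjugateDomain {n : ℕ} (f : E n → ℝ) : Set (E n) :=
  {y | ∃ M, ∀ x, ⟪y, x⟫_ℝ - f x ≤ M}

theorem convex_conjugateDomain {n : ℕ} (f : E n → ℝ) : Convex ℝ (conjugateDomain f) := by
  rintro y ⟨M, hM⟩ z ⟨N, hN⟩ a b ha hb hab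
  refine ⟨a * M + b * N, fun x => ?_⟩
  have h1 := mul_le_mul_of_nonneg_left (hM x) ha
  have h2 := mul_le_mul_of_nonneg_left (hN x) hb
  have h3 : f x = a * f x + b * f x := by rw [← add_mul, hab, one_mul]
  rw [inner_add_left, real_inner_smul_left, real_inner_smul_left]
  linarith

theorem gradient_mem_conjugateDomain {n : ℕ} {f : E n → ℝ} (hf : ConvexOn ℝ univ f) {x : E n}
    (hd : DifferentiableAt ℝ f x) : gradient f x ∈ conjugateDomain f := by
  refine ⟨⟪gradient f x, x⟫_ℝ - f x, fun z => ?_⟩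
  have := add_inner_gradient_le hf hd z
  rw [inner_sub_right] at this
  linarith

/-- In finite dimension a convex set contains the interior of its closure. -/
theorem interior_closure_subset_of_convex {n : ℕ} {C : Set (E n)} (hC : Convex ℝ C) :
    interior (closure C) ⊆ C := by
  rcases (interior (closure C)).eq_empty_or_nonempty with h | h
  · simp [h]
  have hspan : affineSpan ℝ C = ⊤ := by
    rw [← top_le_iff, ← affineSpan_eq_top_of_nonempty_interior
      (h.mono (interior_mono (subset_convexHull ℝ _))), affineSpan_le]
    exact closure_minimal (subset_affineSpan ℝ C) (AffineSubspace.closed_of_finiteDimensional _)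
  rw [hC.interior_closure_eq_interior_of_nonempty_interior
    (hC.interior_nonempty_iff_affineSpan_eq_top.2 hspan)]
  exact interior_subset

theorem convex_polytope {n d : ℕ} (ν : Fin d → E n) (c : Fin d → ℝ) :
    Convex ℝ (polytope ν c) := by
  intro y hy z hz a b ha hb hab k
  have h1 := mul_nonneg ha (hy k)
  have h2 := mul_nonneg hb (hz k)
  have h3 : c k = a * c k + b * c k := by rw [← add_mul, hab, one_mul]
  simp only [affineFn] at h1 h2 ⊢
  rw [inner_add_right, real_inner_smul_right, real_inner_smul_right]
  linarith

theorem continuous_guillemin {n d : ℕ} (ν : Fin d → E n) (c : Fin d → ℝ) :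
    Continuous (guillemin ν c) := by
  unfold guillemin
  refine continuous_finsetSum _ fun k _ => ?_
  exact Real.continuous_mul_log.comp (by unfold affineFn; fun_prop)

/-- The supremum defining the symplectic potential is bounded, uniformly on the polytope. In the
interior the supremum is finite because the image of the gradient is dense, and it is the
continuous function `u_G + F`; the uniform bound then passes to the boundary. -/
theorem exists_conjugate_bound {n d : ℕ} {ν : Fin d → E n} {c : Fin d → ℝ}
    (hP : IsCompact (polytope ν c)) (hPint : (interior (polytope ν c)).Nonempty)
    {ψ₀ : E n → ℝ} (h : IsOpenOrbitPotential ν c ψ₀) :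
    ∃ M, ∀ y ∈ polytope ν c, ∀ x, ⟪y, x⟫_ℝ - ψ₀ x ≤ M := by
  obtain ⟨F, hF, hEq⟩ := h.boundary
  have hd : Differentiable ℝ ψ₀ := h.smooth.differentiable (by simp)
  have hdom : interior (polytope ν c) ⊆ conjugateDomain ψ₀ := by
    refine (interior_mono ?_).trans
      (interior_closure_subset_of_convex (convex_conjugateDomain ψ₀))
    rw [← h.closure_range_gradient]
    refine closure_mono ?_
    rintro _ ⟨x, rfl⟩
    exact gradient_mem_conjugateDomain h.strictConvex.convexOn (hd x)
  obtain ⟨M, hM⟩ := hP.bddAbove_image ((continuous_guillemin ν c).continuousOn.add hF.continuousOn)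
  refine ⟨M, fun y hy x => ?_⟩
  have hclosed : IsClosed {y : E n | ⟪y, x⟫_ℝ - ψ₀ x ≤ M} :=
    isClosed_le (by fun_prop) continuous_const
  refine closure_minimal (s := interior (polytope ν c)) (fun z hz => ?_) hclosed ?_
  · obtain ⟨N, hN⟩ := hdom hz
    have hb : BddAbove (range fun x : (univ : Set (E n)) => ⟪z, (x : E n)⟫_ℝ - ψ₀ x) :=
      ⟨N, by rintro _ ⟨x, rfl⟩; exact hN x⟩
    refine (le_legendre hb (mem_univ x)).trans ?_
    rw [hEq z hz]
    exact hM (mem_image_of_mem _ (interior_subset hz))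
  · rw [(convex_polytope ν c).closure_interior_eq_closure_of_nonempty_interior hPint]
    exact subset_closure hy

/-! ### The subdifferential of the Legendre transform potential -/

section Subdifferential

variable {n : ℕ} {P : Set (E n)} {ψ₀ w : E n → ℝ}

theorem bddAbove_legendrePotential (hP : IsCompact P) (hw : ContinuousOn w P)
    (hψ₀ : ∃ M, ∀ y ∈ P, ∀ x, ⟪y, x⟫_ℝ - ψ₀ x ≤ M) (s : ℝ) (x : E n) :
    BddAbove (range fun y : P => ⟪x, (y : E n)⟫_ℝ - (legendre univ ψ₀ y + s * w y)) := by
  obtain ⟨M, hM⟩ := hψ₀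
  obtain ⟨m, hm⟩ := hP.bddBelow_image
    (continuousOn_const.mul hw : ContinuousOn (fun y => s * w y) P)
  refine bddAbove_inner_sub hP (f := fun y => legendre univ ψ₀ y + s * w y) (m := -ψ₀ 0 + m)
    (fun y hy => ?_) x
  have h1 : m ≤ s * w y := hm (mem_image_of_mem _ hy)
  have h2 : ⟪y, 0⟫_ℝ - ψ₀ 0 ≤ legendre univ ψ₀ y :=
    le_legendre ⟨M, by rintro _ ⟨x, rfl⟩; exact hM y hy x⟩ (mem_univ _)
  rw [inner_zero_right] at h2
  linarith

/-- The step `(r, z)` raises the potential by at most the supremum of `⟨z, ·⟩ - r w` over `P`. -/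
theorem legendrePotential_add_le (hne : P.Nonempty)
    (hbd : ∀ s x, BddAbove (range fun y : P => ⟪x, (y : E n)⟫_ℝ - (legendre univ ψ₀ y + s * w y)))
    {s r a : ℝ} {x z : E n} (ha : ∀ y ∈ P, ⟪z, y⟫_ℝ - r * w y ≤ a) :
    legendrePotential P ψ₀ w (s + r, x + z) ≤ legendrePotential P ψ₀ w (s, x) + a := by
  refine legendre_le hne fun y hy => ?_
  have h1 := ha y hy
  have h2 : _ ≤ legendrePotential P ψ₀ w (s, x) := le_legendre (hbd s x) hy
  simp only at h2 ⊢
  rw [inner_add_left]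
  linarith

/-- The subgradient inequality at `(s, x)` bounds `v` by any bound of `⟨z, ·⟩ - r w` on `P`: the
subgradients lie in the closed convex hull of the graph of `-w`. -/
theorem subgradient_le (hne : P.Nonempty)
    (hbd : ∀ s x, BddAbove (range fun y : P => ⟪x, (y : E n)⟫_ℝ - (legendre univ ψ₀ y + s * w y)))
    {p v : ℝ × E n} (hv : v ∈ subdifferential (legendrePotential P ψ₀ w) p)
    {r a : ℝ} {z : E n} (ha : ∀ y ∈ P, ⟪z, y⟫_ℝ - r * w y ≤ a) :
    r * v.1 + ⟪v.2, z⟫_ℝ ≤ a := by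
  have h1 := hv (p.1 + r, p.2 + z)
  have h2 := legendrePotential_add_le hne hbd (s := p.1) (x := p.2) ha
  simp only [add_sub_cancel_left] at h1
  linarith

/-- The second component of a subgradient lies in the polytope. -/
theorem snd_mem_polytope {d : ℕ} {ν : Fin d → E n} {c : Fin d → ℝ}
    (hne : (polytope ν c).Nonempty)
    (hbd : ∀ s x, BddAbove (range fun y : polytope ν c =>
      ⟪x, (y : E n)⟫_ℝ - (legendre univ ψ₀ y + s * w y)))
    {p v : ℝ × E n} (hv : v ∈ subdifferential (legendrePotential (polytope ν c) ψ₀ w) p) :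
    v.2 ∈ polytope ν c := by
  intro k
  have := subgradient_le hne hbd hv (r := 0) (z := -ν k) (a := -c k) fun y hy => by
    have := hy k
    simp only [affineFn] at this
    rw [inner_neg_left]
    linarith
  rw [inner_neg_right, real_inner_comm] at this
  simp only [affineFn]
  linarith

theorem biconjugate_snd_le_neg_fst (hne : P.Nonempty)
    (hbd : ∀ s x, BddAbove (range fun y : P => ⟪x, (y : E n)⟫_ℝ - (legendre univ ψ₀ y + s * w y)))
    (hw : ∀ x, BddAbove (range fun y : P => ⟪x, (y : E n)⟫_ℝ - w y))
    {p v : ℝ × E n} (hv : v ∈ subdifferential (legendrePotential P ψ₀ w) p) :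
    biconjugate P w v.2 ≤ -v.1 := by
  refine legendre_le univ_nonempty fun z _ => ?_
  have := subgradient_le hne hbd hv (r := 1) (z := z) (a := legendre P w z) fun y hy => by
    simpa using le_legendre (hw z) hy
  linarith

theorem legendrePotential_zero_le (hne : P.Nonempty)
    (hψ₀ : ∃ M, ∀ y ∈ P, ∀ x, ⟪y, x⟫_ℝ - ψ₀ x ≤ M) (x : E n) :
    legendrePotential P ψ₀ w (0, x) ≤ ψ₀ x := by
  obtain ⟨M, hM⟩ := hψ₀
  refine legendre_le hne fun y hy => ?_
  have : ⟪y, x⟫_ℝ - ψ₀ x ≤ legendre univ ψ₀ y :=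
    le_legendre ⟨M, by rintro _ ⟨x, rfl⟩; exact hM y hy x⟩ (mem_univ _)
  rw [real_inner_comm] at this
  simp only [zero_mul, add_zero]
  linarith

/-- Comparing with the slice `s = 0`, where `ψ ≤ ψ₀`, gives
`u₀(v₂) ≤ s v₁ + ⟨v₂, x⟩ - ψ(s, x)`, while `ψ(s, x) ≥ ⟨x, v₂⟩ - u₀(v₂) - s w(v₂)` by definition;
adding the two leaves `0 ≤ s (v₁ + w(v₂))`. -/
theorem neg_le_fst_of_pos (hne : P.Nonempty)
    (hbd : ∀ s x, BddAbove (range fun y : P => ⟪x, (y : E n)⟫_ℝ - (legendre univ ψ₀ y + s * w y)))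
    (hψ₀ : ∃ M, ∀ y ∈ P, ∀ x, ⟪y, x⟫_ℝ - ψ₀ x ≤ M)
    {p v : ℝ × E n} (hv : v ∈ subdifferential (legendrePotential P ψ₀ w) p) (hv2 : v.2 ∈ P)
    (hp : 0 < p.1) : -w v.2 ≤ v.1 := by
  have h1 : legendre univ ψ₀ v.2 ≤ v.1 * p.1 + ⟪v.2, p.2⟫_ℝ - legendrePotential P ψ₀ w p := by
    refine legendre_le univ_nonempty fun z _ => ?_
    have h := hv (0, z)
    have h' := legendrePotential_zero_le (w := w) hne hψ₀ z
    simp only [inner_sub_right] at h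
    linarith
  have h2 : _ ≤ legendrePotential P ψ₀ w p := le_legendre (hbd p.1 p.2) hv2
  rw [real_inner_comm] at h2
  have h3 : 0 ≤ p.1 * (v.1 + w v.2) := by linarith
  linarith [nonneg_of_mul_nonneg_right h3 hp]

/-- On the initial slice, where the previous bound degenerates, it still holds: the maximum defining
`ψ(0, x)` is attained only at `∇ψ₀ x`, so that, for small `τ > 0`, the maximum defining `ψ(-τ, x)`
is nearly attained only where `w` is at most slightly larger than at `∇ψ₀ x`. -/
theorem neg_le_fst_of_zero (hP : IsCompact P) (hw : ContinuousOn w P)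
    (hψ₀ : ∃ M, ∀ y ∈ P, ∀ x, ⟪y, x⟫_ℝ - ψ₀ x ≤ M)
    (hconv : ConvexOn ℝ univ ψ₀) (hd : Differentiable ℝ ψ₀) (hgrad : ∀ x, gradient ψ₀ x ∈ P)
    {x : E n} {v : ℝ × E n} (hv : v ∈ subdifferential (legendrePotential P ψ₀ w) (0, x)) :
    -w v.2 ≤ v.1 := by
  have hne : P.Nonempty := ⟨_, hgrad x⟩
  have hbd := bddAbove_legendrePotential hP hw hψ₀
  have hle := legendrePotential_zero_le (w := w) hne hψ₀
  obtain ⟨M, hM⟩ := hψ₀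
  have hfin : ∀ y ∈ P, BddAbove (range fun x : (univ : Set (E n)) => ⟪y, (x : E n)⟫_ℝ - ψ₀ x) :=
    fun y hy => ⟨M, by rintro _ ⟨x, rfl⟩; exact hM y hy x⟩
  have hge : ψ₀ x ≤ legendrePotential P ψ₀ w (0, x) := by
    have h1 : _ ≤ legendrePotential P ψ₀ w (0, x) := le_legendre (hbd 0 x) (hgrad x)
    have h2 : legendre univ ψ₀ (gradient ψ₀ x) ≤ ⟪gradient ψ₀ x, x⟫_ℝ - ψ₀ x :=
      legendre_le univ_nonempty fun z _ => by
        have := add_inner_gradient_le hconv (hd x) z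
        rw [inner_sub_right] at this
        linarith
    rw [real_inner_comm] at h1
    simp only [zero_mul, add_zero] at h1
    linarith
  have hv2 : v.2 = gradient ψ₀ x := eq_gradient_of_forall_le (hd x) fun z => by
    have := hv (0, z)
    simp only [sub_self, mul_zero, zero_add] at this
    linarith [hle z]
  refine le_of_forall_pos_le_add fun ε hε => ?_
  obtain ⟨B, hB⟩ := hP.bddAbove_image hw
  -- The compact set where `w` exceeds its value at `∇ψ₀ x` by at least `ε`.
  set K : Set (E n) := P ∩ w ⁻¹' Ici (w v.2 + ε) with hK
  have hKc : IsCompact K := by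
    exact hP.of_isClosed_subset (hw.preimage_isClosed_of_isClosed hP.isClosed isClosed_Ici)
      inter_subset_left
  have hgap : ∃ δ > 0, ∀ y ∈ K, ⟪x, y⟫_ℝ - legendre univ ψ₀ y ≤ ψ₀ x - δ := by
    rcases K.eq_empty_or_nonempty with h | h
    · exact ⟨1, one_pos, by simp [h]⟩
    have hlsc : LowerSemicontinuousOn (fun y => ⨆ z : (univ : Set (E n)),
        (⟪y, (z : E n)⟫_ℝ - ψ₀ z - ⟪x, y⟫_ℝ)) K := by
      refine lowerSemicontinuousOn_ciSup (fun y hy => ?_) fun z =>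
        (Continuous.lowerSemicontinuous (by fun_prop)).lowerSemicontinuousOn _
      obtain ⟨C, hC⟩ := hfin y hy.1
      exact ⟨C - ⟪x, y⟫_ℝ, by rintro _ ⟨z, rfl⟩; exact sub_le_sub_right (hC ⟨z, rfl⟩) _⟩
    obtain ⟨y, hy, hmin⟩ := hlsc.exists_isMinOn h hKc
    have heq : ∀ y ∈ K, (⨆ z : (univ : Set (E n)), (⟪y, (z : E n)⟫_ℝ - ψ₀ z - ⟪x, y⟫_ℝ)) =
        legendre univ ψ₀ y - ⟪x, y⟫_ℝ := fun y hy => (ciSup_sub (hfin y hy.1) _).symm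
    have hlt : ⟪x, y⟫_ℝ - legendre univ ψ₀ y < ψ₀ x := by
      by_contra! hcon
      -- Equality in the Fenchel-Young inequality forces `y = ∇ψ₀ x`.
      have hy' : y = gradient ψ₀ x := eq_gradient_of_forall_le (hd x) fun z => by
        have := le_legendre (hfin y hy.1) (mem_univ z)
        rw [inner_sub_right, real_inner_comm x y]
        linarith
      have := hy.2
      rw [hy', ← hv2, mem_preimage, mem_Ici] at this
      linarith
    refine ⟨ψ₀ x - (⟪x, y⟫_ℝ - legendre univ ψ₀ y), sub_pos.2 hlt, fun y' hy' => ?_⟩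
    have := hmin hy'
    simp only [mem_ofPred_eq] at this
    rw [heq y hy, heq y' hy'] at this
    linarith
  obtain ⟨δ, hδ, hgap⟩ := hgap
  -- A step so small that the points of `K`, losing `δ`, cannot compete with `∇ψ₀ x`.
  obtain ⟨τ, hτ, hτδ⟩ : ∃ τ > 0, τ * (B - w v.2) ≤ δ := by
    have hB' : 0 ≤ B - w v.2 := sub_nonneg.2 (hB (mem_image_of_mem _ (hv2 ▸ hgrad x)))
    refine ⟨δ / (B - w v.2 + 1), by positivity, ?_⟩
    rw [div_mul_eq_mul_div, div_le_iff₀ (by positivity)]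
    nlinarith
  have hup : legendrePotential P ψ₀ w (-τ, x) ≤ ψ₀ x + τ * (w v.2 + ε) := by
    refine legendre_le hne fun y hy => ?_
    simp only
    have hFY : ⟪x, y⟫_ℝ - legendre univ ψ₀ y ≤ ψ₀ x := by
      have := le_legendre (hfin y hy) (mem_univ x)
      rw [real_inner_comm] at this
      linarith
    by_cases hyK : y ∈ K
    · have h1 := hgap y hyK
      have h2 : τ * w y ≤ τ * B := mul_le_mul_of_nonneg_left (hB (mem_image_of_mem _ hy)) hτ.le
      have h3 : 0 < τ * ε := mul_pos hτ hε
      linarith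
    · have h1 : w y < w v.2 + ε := not_le.1 fun h => hyK ⟨hy, h⟩
      have h2 := mul_le_mul_of_nonneg_left h1.le hτ.le
      linarith
  have h1 := hv (-τ, x)
  simp only [sub_zero, sub_self, inner_zero_right, add_zero] at h1
  have h2 : 0 ≤ τ * (v.1 + (w v.2 + ε)) := by linarith
  linarith [nonneg_of_mul_nonneg_right h2 hτ]

end Subdifferential

theorem proposition3 {n d : ℕ} (ν : Fin d → HRMA.E n) (c : Fin d → ℝ)
    (hP : IsCompact (HRMA.polytope ν c)) (hPint : (interior (HRMA.polytope ν c)).Nonempty)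
    (ψ₀ ψdot udot : HRMA.E n → ℝ)
    (hψ₀ : HRMA.IsOpenOrbitPotential ν c ψ₀)
    (hudot : HRMA.IsInitialVelocity (HRMA.polytope ν c) ψ₀ ψdot udot)
    (T : ℝ) (hT : 0 < T) :
    HRMA.mongeAmpere (HRMA.legendrePotential (HRMA.polytope ν c) ψ₀ udot)
        (Set.Icc 0 T ×ˢ Set.univ) ≤
      volume (HRMA.epi (HRMA.polytope ν c) (fun y => -udot y) \
        HRMA.epi (HRMA.polytope ν c)
          (fun y => -HRMA.biconjugate (HRMA.polytope ν c) udot y)) ∧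
    volume (HRMA.epi (HRMA.polytope ν c) (fun y => -udot y) \
        HRMA.epi (HRMA.polytope ν c)
          (fun y => -HRMA.biconjugate (HRMA.polytope ν c) udot y)) =
      volume {q : HRMA.E n × ℝ | q.1 ∈ HRMA.polytope ν c ∧
        HRMA.biconjugate (HRMA.polytope ν c) udot q.1 ≤ q.2 ∧ q.2 ≤ udot q.1} := by
  set P := polytope ν c with hPdef
  have hne : P.Nonempty := hPint.mono interior_subset
  have hw : ContinuousOn udot P := hudot.smooth.continuousOn
  have hfin := exists_conjugate_bound hP hPint hψ₀
  have hbd := bddAbove_legendrePotential hP hw hfin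
  have hwbd : ∀ x, BddAbove (range fun y : P => ⟪x, (y : E n)⟫_ℝ - udot y) := by
    obtain ⟨m, hm⟩ := hP.bddBelow_image hw
    exact bddAbove_inner_sub hP fun y hy => hm (mem_image_of_mem _ hy)
  have hd : Differentiable ℝ ψ₀ := hψ₀.smooth.differentiable (by simp)
  have hgrad : ∀ x, gradient ψ₀ x ∈ P := fun x => by
    rw [hPdef, ← hψ₀.closure_range_gradient]
    exact subset_closure (mem_range_self x)
  have hnull := volume_graph_eq_zero (isClosed_epi_biconjugate hP.isClosed hwbd).measurableSet
  -- The reflected closed region agrees with the difference of epigraphs up to the null graph.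
  have hregion : volume (epi P (fun y => -udot y) \ epi P (fun y => -biconjugate P udot y)) =
      volume {q : E n × ℝ | q.1 ∈ P ∧ biconjugate P udot q.1 ≤ q.2 ∧ q.2 ≤ udot q.1} := by
    rw [← volume_preimage_neg_snd]
    rw [← measure_sdiff_null (s := {q : E n × ℝ | q.1 ∈ P ∧ _}) hnull]
    congr 1
    ext q
    simp only [epi, mem_preimage, mem_sdiff, mem_ofPred_eq, not_and, not_le]
    constructor
    · rintro ⟨⟨hq, h1⟩, h2⟩
      have := h2 hq
      exact ⟨⟨hq, by linarith, by linarith⟩, fun _ h => by linarith⟩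
    · rintro ⟨⟨hq, h1, h2⟩, h3⟩
      have := lt_of_le_of_ne h1 (Ne.symm (h3 hq))
      exact ⟨⟨hq, by linarith⟩, fun _ => by linarith⟩
  refine ⟨?_, hregion⟩
  rw [hregion, ← volume_preimage_neg_snd, ← volume_preimage_swap]
  refine measure_mono (iUnion₂_subset fun p hp v hv => ?_)
  have hv2 : v.2 ∈ P := snd_mem_polytope hne hbd hv
  have hlow : -udot v.2 ≤ v.1 := by
    rcases hp.1.1.eq_or_lt with h0 | h0
    · obtain ⟨s, x⟩ := p
      obtain rfl : 0 = s := h0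
      exact neg_le_fst_of_zero hP hw hfin hψ₀.strictConvex.convexOn hd hgrad hv
    · exact neg_le_fst_of_pos hne hbd hfin hv hv2 h0
  refine ⟨hv2, biconjugate_snd_le_neg_fst hne hbd hwbd hv, ?_⟩
  simp only [Prod.fst_swap, Prod.snd_swap]
  linarith
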